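/- Let $G=(V,E)$ be a finite directed graph (loops and multiple edges allowed) with source and range maps $s,r:E\to V$. Suppose that $G$ is transitive (there is a path from any vertex to any other vertex), in-degree $d$-regular ($|r^{-1}(v)|=d$ for every $v\in V$), and $p$-periodic, i.e. $p\ge 1$ is the largest integer for which there is a partition $V=\bigsqcup_{i\in\mathbb Z/p}V_i$ into nonempty sets such that every edge $e$ with $s(e)\in V_i$ has $r(e)\in V_{i+1}$. Fix such a partition for this $p$ (the cyclic decomposition of $G$; the $V_i$ are its cyclic components). A strong edge coloring of $G$ with $d$ colors is a map $c:E\to\{1,\dots,d\}$ such that $c(e)\ne c(f)$ whenever $e\neq f$ and $r(e)=r(f)$. For such $c$, every vertex $v$ and every finite word $\gamma=i_1\cdots i_n$ in the colors determine a unique path $\lambda=e_1\cdots e_n$ with $r(e_1)=v$, $s(e_j)=r(e_{j+1})$ for $1\le j<n$, and $c(e_j)=i_j$ for all $j$; its source is $s(e_n)$ (for the empty word, the path has length $0$ and source $v$). A word $\gamma$ is called $p$-synchronizing for a tuple $(v_i)_{i\in\mathbb Z/p}$ with $v_i\in V_i$ if, for every $i$ and every $v\in V_i$, the path with range $v$ and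 color word $\gamma$ has source $v_i$; and $c$ is called $p$-synchronizing if there are such a tuple and such a word. Then there is a strong edge coloring $c:E\to\{1,\dots,d\}$ of $G$ that is $p$-synchronizing. Furthermore, for every strong edge coloring $c:E\to\{1,\dots,d\}$: if $\gamma$ is a $p$-synchronizing word for a tuple $(v_i)_{i\in\mathbb Z/p}$ and $w_i\in V_i$ is any vertex, for some $i$, then there are vertices $w_j\in V_j$ for all $j\neq i$ and a word $\mu$ that is $p$-synchronizing (for the same coloring $c$) for the tuple $(w_j)_{j\in\mathbb Z/p}$. -/

import Mathlib

/-- A directed graph with vertex set `V` and edge set `E`, given by its source and range maps;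
loops and multiple edges are allowed. -/
structure DirectedGraph (V : Type*) (E : Type*) where
  /-- the source map -/
  s : E → V
  /-- the range map -/
  r : E → V

namespace DirectedGraph

/-- `G.IsPath l v w`: the list of edges `l = [e₁, …, eₙ]` is a path with range `v` and source `w`,
that is, `r(e₁) = v`, `s(eⱼ) = r(eⱼ₊₁)` for `1 ≤ j < n`, and `s(eₙ) = w`.
The empty list is the path of length zero at a vertex. -/
def IsPath {V E : Type*} (G : DirectedGraph V E) : List E → V → V → Prop
  | [], v, w => v = w
  | e :: l, v, w => G.r e = v ∧ G.IsPath l (G.s e) w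

/-- There is a path from any vertex to any other vertex. -/
def IsTransitive {V E : Type*} (G : DirectedGraph V E) : Prop :=
  ∀ v w : V, ∃ l : List E, G.IsPath l v w

/-- Every vertex is the range of exactly `d` edges. -/
def InDegreeRegular {V E : Type*} (G : DirectedGraph V E) (d : ℕ) : Prop :=
  ∀ v : V, Nat.card {e : E // G.r e = v} = d

/-- `U` is a partition of the vertices into `p ≥ 1` nonempty sets, indexed cyclically, such that
every edge with source in `U i` has its range in `U (i + 1)`. -/
structure IsCyclicPartition {V E : Type*} (G : DirectedGraph V E) (p : ℕ)
    (U : ZMod p → Set V) : Prop where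
  pos : 0 < p
  nonempty : ∀ i, (U i).Nonempty
  disjoint : ∀ i j, i ≠ j → Disjoint (U i) (U j)
  cover : ⋃ i, U i = Set.univ
  edge : ∀ (e : E) (i : ZMod p), G.s e ∈ U i → G.r e ∈ U (i + 1)

/-- `G` has period `p`: `p` is the largest integer for which there is a cyclic partition of the
vertices into `p` sets. -/
def HasPeriod {V E : Type*} (G : DirectedGraph V E) (p : ℕ) : Prop :=
  IsGreatest {q : ℕ | ∃ U : ZMod q → Set V, G.IsCyclicPartition q U} p

/-- Distinct edges with the same range have distinct colors. -/
def IsStrongEdgeColoring {V E : Type*} (G : DirectedGraph V E) {d : ℕ} (c : E → Fin d) : Prop :=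
  ∀ e f : E, e ≠ f → G.r e = G.r f → c e ≠ c f

/-- For a strong edge coloring, a path is determined by its range and its color word. -/
theorem IsStrongEdgeColoring.path_unique {V E : Type*} {G : DirectedGraph V E} {d : ℕ}
    {c : E → Fin d} (hc : G.IsStrongEdgeColoring c) :
    ∀ {l l' : List E} {v w w' : V}, G.IsPath l v w → G.IsPath l' v w' →
      l.map c = l'.map c → l = l' ∧ w = w'
  | [], [], _, _, _, h, h', _ => ⟨rfl, Eq.trans (Eq.symm h) h'⟩
  | [], _ :: _, _, _, _, _, _, hm => by simp at hm
  | _ :: _, [], _, _, _, _, _, hm => by simp at hm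
  | e :: l, f :: l', _, _, _, h, h', hm => by
    simp only [List.map_cons, List.cons.injEq] at hm
    have hef : e = f := by
      by_contra hne
      exact hc e f hne (h.1.trans h'.1.symm) hm.1
    subst hef
    obtain ⟨h1, h2⟩ := path_unique hc h.2 h'.2 hm.2
    exact ⟨by rw [h1], h2⟩

/-- `γ` is a `p`-synchronizing word for the tuple `x` (with respect to the coloring `c` and the
cyclic components `U i`): `x i ∈ U i` for every `i`, and for every `v ∈ U i` the backward path with
range `v` and color word `γ` (unique, if `c` is a strong edge coloring) has source `x i`. -/
def IsSynchronizingWord {V E : Type*} (G : DirectedGraph V E) {d p : ℕ} (c : E → Fin d)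
    (U : ZMod p → Set V) (x : ZMod p → V) (γ : List (Fin d)) : Prop :=
  (∀ i, x i ∈ U i) ∧
    ∀ i, ∀ v ∈ U i, ∃ l : List E, G.IsPath l v (x i) ∧ l.map c = γ

/-- The coloring `c` is `p`-synchronizing: some word is `p`-synchronizing for some tuple of
distinguished vertices, one in each cyclic component. -/
def IsSynchronizing {V E : Type*} (G : DirectedGraph V E) {d p : ℕ} (c : E → Fin d)
    (U : ZMod p → Set V) : Prop :=
  ∃ (x : ZMod p → V) (γ : List (Fin d)), G.IsSynchronizingWord c U x γ

end DirectedGraph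

/-! Reading colors backward along edges turns a strong edge coloring into a complete automaton, and
changing the coloring permutes the labels at each state. Two states are stable if, whatever word is
read, the resulting states can still be merged. Stability is a congruence. If some recoloring has a
stable pair of distinct states, its quotient is a smaller connected automaton, and a good recoloring
of the quotient lifts (`sync_recolor_of_stable`). The induction in `exists_recolor_sync` stops only
when each state has a single successor: the graph is then a cycle, labelled by `ZMod n`.

The heart, due to Trahtman, is to find a stable pair (`exists_recolor_stable`). Two states whose
edges all end in one common state already form one. Otherwise some choice of one edge per state
gives a map whose highest points all hang from the same cycle point, a dominant tree. Made into a
single letter, this map moves one minimal image to another that differs from it in one element, and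
the two differing elements are stable. The dominant tree comes from an extremal choice: most
periodic points, then greatest height. If no tree dominates, redirecting a cycle edge yields a
mirror extremal choice (`IsExtremal.mirror`), and the last vertices before the root in the two
pictures send all their edges to that root, which was excluded.

Finally, `n` is at most `p` by maximality of the period, while a merging word shows that the
`n`-labelling refines the given components; hence the two partitions agree. -/

namespace RoadColoring

open Function Set

/-! ### Heights and roots of a self-map of a finite set. -/

section Functional

variable {V : Type*}

/-- The number of steps after which the orbit of `x` enters a cycle of `f`. -/
noncomputable def height (f : V → V) (x : V) : ℕ := sInf {n | f^[n] x ∈ periodicPts f}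

/-- The first periodic point on the orbit of `x`. -/
noncomputable def root (f : V → V) (x : V) : V := f^[height f x] x

/-- All the points above a certain height (and there are some) belong to the same tree. -/
def HasDominantTree (f : V → V) : Prop :=
  ∃ (L : ℕ) (r : V), (∃ v, L < height f v) ∧ ∀ v, L < height f v → root f v = r

theorem iterate_mem_periodicPts {f : V → V} {x : V} (hx : x ∈ periodicPts f) (n : ℕ) :
    f^[n] x ∈ periodicPts f :=
  (bijOn_periodicPts f).mapsTo.iterate n hx

theorem exists_iterate_mem_periodicPts [Finite V] (f : V → V) (x : V) :
    ∃ n, f^[n] x ∈ periodicPts f := by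
  obtain ⟨a, b, hab, h⟩ := Finite.exists_ne_map_eq_of_infinite (fun n : ℕ => f^[n] x)
  wlog hlt : a < b generalizing a b
  · exact this b a hab.symm h.symm (by omega)
  refine ⟨a, mk_mem_periodicPts (n := b - a) (by omega) ?_⟩
  change f^[b - a] (f^[a] x) = f^[a] x
  rw [← iterate_add_apply, Nat.sub_add_cancel hlt.le]
  exact h.symm

theorem root_mem_periodicPts [Finite V] (f : V → V) (x : V) : root f x ∈ periodicPts f :=
  Nat.sInf_mem (exists_iterate_mem_periodicPts f x)

theorem height_le {f : V → V} {x : V} {n : ℕ} (h : f^[n] x ∈ periodicPts f) : height f x ≤ n :=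
  Nat.sInf_le h

theorem iterate_notMem_of_lt_height {f : V → V} {x : V} {n : ℕ} (h : n < height f x) :
    f^[n] x ∉ periodicPts f :=
  Nat.notMem_of_lt_sInf h

theorem iterate_mem_of_height_le [Finite V] {f : V → V} {x : V} {n : ℕ} (h : height f x ≤ n) :
    f^[n] x ∈ periodicPts f := by
  have := iterate_mem_periodicPts (root_mem_periodicPts f x) (n - height f x)
  rwa [root, ← iterate_add_apply, Nat.sub_add_cancel h] at this

theorem iterate_mem_iff [Finite V] {f : V → V} {x : V} {n : ℕ} :
    f^[n] x ∈ periodicPts f ↔ height f x ≤ n :=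
  ⟨height_le, iterate_mem_of_height_le⟩

theorem height_eq_zero_iff [Finite V] {f : V → V} {x : V} :
    height f x = 0 ↔ x ∈ periodicPts f := by
  rw [← Nat.le_zero, ← iterate_mem_iff, iterate_zero_apply]

theorem height_pos_iff [Finite V] {f : V → V} {x : V} :
    0 < height f x ↔ x ∉ periodicPts f := by
  rw [← height_eq_zero_iff, Nat.pos_iff_ne_zero]

theorem height_iterate [Finite V] (f : V → V) (x : V) (n : ℕ) :
    height f (f^[n] x) = height f x - n := by
  apply eq_of_forall_ge_iff
  intro c
  rw [← iterate_mem_iff, ← iterate_add_apply, iterate_mem_iff]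
  omega

theorem root_iterate [Finite V] {f : V → V} {x : V} {n : ℕ} (h : n ≤ height f x) :
    root f (f^[n] x) = root f x := by
  rw [root, root, height_iterate, ← iterate_add_apply, Nat.sub_add_cancel h]

theorem height_apply [Finite V] {f : V → V} {x : V} (h : x ∉ periodicPts f) :
    height f x = height f (f x) + 1 := by
  have := height_iterate f x 1
  have := height_pos_iff.2 h
  simp only [iterate_one] at *
  omega

theorem root_apply [Finite V] {f : V → V} {x : V} (h : x ∉ periodicPts f) :
    root f (f x) = root f x :=
  root_iterate (n := 1) (height_pos_iff.2 h)

/-- If `g` is injective on an invariant set `F` up to collisions with value `r`, then `r` is the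
root of all nonperiodic points of `F`. -/
theorem root_eq_of_collision [Finite V] {g : V → V} {F : Set V} {r x : V} (hF : MapsTo g F F)
    (hr : ∀ w ∈ F, ∀ z ∈ F, w ≠ z → g w = g z → g w = r) (hx : x ∈ F)
    (hxp : x ∉ periodicPts g) : root g x = r := by
  have hpos := height_pos_iff.2 hxp
  -- The root has a predecessor on its cycle besides the last nonperiodic point of the orbit of `x`;
  -- these two collide.
  obtain ⟨z, hz, hzr⟩ := (bijOn_periodicPts g).surjOn (root_mem_periodicPts g x)
  have hw : g (g^[height g x - 1] x) = root g x := by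
    rw [← iterate_succ_apply' g, Nat.succ_eq_add_one, Nat.sub_add_cancel hpos, root]
  have hwp : g^[height g x - 1] x ∉ periodicPts g := iterate_notMem_of_lt_height (by omega)
  have hzF : z ∈ F := by
    obtain ⟨n, hn, hnz⟩ := hz
    have h1 : g^[n - 1] (root g x) = z := by
      rw [← hzr, ← iterate_succ_apply g, Nat.succ_eq_add_one, Nat.sub_add_cancel hn]
      exact hnz
    rw [← h1]
    exact hF.iterate _ (hF.iterate _ hx)
  rw [← hw]
  exact hr _ (hF.iterate _ hx) z hzF (fun h => hwp (h ▸ hz)) (hw.trans hzr.symm)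

/-! ### Extremal maps and the redirection of one value. -/

/-- Among the functions in `S`, `f` has the largest number of periodic points, and among those
functions and their points, `f` and `p` have the largest height. -/
structure IsExtremal (S : Set (V → V)) (f : V → V) (p : V) : Prop where
  mem : f ∈ S
  ncard_le : ∀ g ∈ S, (periodicPts g).ncard ≤ (periodicPts f).ncard
  height_le : ∀ g ∈ S, (periodicPts g).ncard = (periodicPts f).ncard →
    ∀ q, height g q ≤ height f p

theorem exists_isExtremal [Finite V] [Nonempty V] {S : Set (V → V)} (hS : S.Nonempty) :
    ∃ f p, IsExtremal S f p := by
  have : Nonempty S := hS.to_subtype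
  obtain ⟨⟨f, p⟩, hmax⟩ := Finite.exists_max
    fun x : S × V => toLex ((periodicPts x.1.1).ncard, height x.1.1 x.2)
  refine ⟨f, p, f.2, fun g hg => ?_, fun g hg hcard q => ?_⟩
  · rcases Prod.Lex.toLex_le_toLex.1 (hmax (⟨g, hg⟩, p)) with h | h
    · exact h.le
    · exact h.1.le
  · rcases Prod.Lex.toLex_le_toLex.1 (hmax (⟨g, hg⟩, q)) with h | h
    · exact absurd hcard h.ne
    · exact h.2

variable [DecidableEq V]

theorem iterate_update {f : V → V} {u s x : V} {n : ℕ} (h : ∀ k < n, f^[k] x ≠ u) :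
    (update f u s)^[n] x = f^[n] x := by
  induction n with
  | zero => rfl
  | succ n ih =>
    rw [iterate_succ_apply', iterate_succ_apply', ih fun k hk => h k (by omega),
      update_of_ne (h n (by omega))]

theorem mem_periodicPts_update {f : V → V} {u s x : V} (hx : x ∈ periodicPts f)
    (h : ∀ k, f^[k] x ≠ u) : x ∈ periodicPts (update f u s) := by
  obtain ⟨n, hn, hx⟩ := hx
  exact ⟨n, hn, (iterate_update fun k _ => h k).trans hx⟩

theorem periodicPts_subset_update {f : V → V} {u : V} (s : V) (hu : u ∉ periodicPts f) :
    periodicPts f ⊆ periodicPts (update f u s) := fun _ hx =>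
  mem_periodicPts_update hx fun k h => hu (h ▸ iterate_mem_periodicPts hx k)

/-- The orbit of a point can be followed until it first meets `u`. -/
theorem exists_iterate_update_eq {f : V → V} {u x : V} (s : V) (h : ∃ k, f^[k] x = u) :
    ∃ k, f^[k] x = u ∧ (∀ j < k, f^[j] x ≠ u) ∧ ∀ j ≤ k, (update f u s)^[j] x = f^[j] x := by
  classical
  refine ⟨Nat.find h, Nat.find_spec h, fun j hj => Nat.find_min h hj, fun j hj =>
    iterate_update fun i hi => Nat.find_min h (by omega)⟩

/-- A periodic point of `f` which is no longer periodic after redirecting `u` lies on the new orbit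
of `f u`. -/
theorem exists_iterate_update_apply_eq {f : V → V} {u s x : V} (hx : x ∈ periodicPts f)
    (hx' : x ∉ periodicPts (update f u s)) :
    ∃ b, (update f u s)^[b] (f u) = x ∧ f^[b] (f u) = x := by
  classical
  obtain ⟨a, ha⟩ : ∃ a, f^[a] x = u := by
    by_contra! h
    exact hx' (mem_periodicPts_update hx h)
  have hex : ∃ b, f^[b] (f u) = x := by
    obtain ⟨n, hn, hnx⟩ := hx
    -- Since `f u` is `a + 1` steps after `x`, this completes a whole number of periods.
    refine ⟨n * (a + 1) - (a + 1), ?_⟩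
    rw [← ha, ← iterate_succ_apply' f, ← iterate_add_apply, Nat.succ_eq_add_one,
      Nat.sub_add_cancel (Nat.le_mul_of_pos_left _ hn)]
    exact hnx.mul_const (a + 1)
  refine ⟨Nat.find hex, ?_, Nat.find_spec hex⟩
  rw [iterate_update, Nat.find_spec hex]
  -- A visit to `u` at time `i` would close a loop of length `i + 1` at `f u`; cutting it out
  -- contradicts minimality.
  intro i hi h
  refine Nat.find_min hex (m := Nat.find hex - (i + 1)) (by omega) ?_
  refine Eq.trans ?_ (Nat.find_spec hex)
  conv_rhs => rw [show Nat.find hex = (Nat.find hex - (i + 1)) + 1 + i by omega,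
    iterate_add_apply, h, iterate_add_apply, iterate_one]

/-- Redirecting one value of a permutation creates a single tree. -/
theorem hasDominantTree_update_of_injective [Finite V] {f : V → V} (hf : Injective f) {u s : V}
    (hs : s ≠ f u) : HasDominantTree (update f u s) := by
  refine ⟨0, s, ?_, fun v hv => ?_⟩
  · by_contra! h
    obtain ⟨z, hz⟩ := (Finite.injective_iff_surjective.1 hf) s
    have hinj : Injective (update f u s) := by
      rw [injective_iff_periodicPts_eq_univ, eq_univ_iff_forall]
      exact fun v => height_eq_zero_iff.1 (Nat.le_zero.1 (h v))
    have hzu : z ≠ u := fun h => hs (by rw [← hz, h])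
    exact hzu (hinj (by rw [update_of_ne hzu, update_self, hz]))
  · refine root_eq_of_collision (F := univ) (mapsTo_univ _ _) (fun w _ z _ hwz h => ?_) trivial
      (height_pos_iff.1 hv)
    by_cases hw : w = u
    · rw [hw, update_self]
    by_cases hz : z = u
    · rw [h, hz, update_self]
    rw [update_of_ne hw, update_of_ne hz] at h
    exact absurd (hf h) hwz

theorem IsExtremal.periodicPts_update_eq [Finite V] {S : Set (V → V)} {f : V → V} {p u s : V}
    (h : IsExtremal S f p) (hu : u ∉ periodicPts f) (hS : update f u s ∈ S) :
    periodicPts f = periodicPts (update f u s) :=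
  Set.eq_of_subset_of_ncard_le (periodicPts_subset_update s hu) (h.ncard_le _ hS)

/-- A nonperiodic `u` redirected to `p` either closes a new cycle, if the orbit of `p` meets `u`, or
stands one step higher than `p`. Extremality forbids both. -/
theorem IsExtremal.mem_periodicPts_of_update_mem [Finite V] {S : Set (V → V)} {f : V → V} {p u : V}
    (h : IsExtremal S f p) (hS : update f u p ∈ S) : u ∈ periodicPts f := by
  by_contra hu
  have heq := h.periodicPts_update_eq hu hS
  have hu' : u ∉ periodicPts (update f u p) := heq ▸ hu
  by_cases hex : ∃ k, f^[k] p = u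
  · obtain ⟨k, hk, -, hk'⟩ := exists_iterate_update_eq p hex
    refine hu' ⟨k + 1, k.succ_pos, ?_⟩
    change (update f u p)^[k + 1] u = u
    rw [iterate_succ_apply, update_self, hk' k le_rfl, hk]
  · push Not at hex
    have h1 : height (update f u p) p = height f p := by
      refine eq_of_forall_ge_iff fun c => ?_
      rw [← iterate_mem_iff, ← iterate_mem_iff, iterate_update fun k _ => hex k, heq]
    have h2 := height_apply hu'
    have h3 := h.height_le _ hS (by rw [heq]) u
    rw [update_self, h1] at h2
    omega

/-- In the extremal case, redirecting a predecessor `u` of `p` to `p` gives a dominant tree, unless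
the new situation is extremal as well and mirrors the old one. -/
theorem IsExtremal.mirror [Finite V] {S : Set (V → V)} {f : V → V} {p u : V}
    (h : IsExtremal S f p) (hp : 0 < height f p) (hS : update f u p ∈ S)
    (hdom : ¬ HasDominantTree (update f u p)) :
    f^[height f p] (f u) = root f p ∧ IsExtremal S (update f u p) (f u) ∧
      height (update f u p) (f u) = height f p ∧ root (update f u p) (f u) = root f p ∧
      ∀ i ≤ height f p, (update f u p)^[i] (f u) = f^[i] (f u) := by
  have hu := h.mem_periodicPts_of_update_mem hS
  obtain ⟨g, hg⟩ : ∃ g, g = update f u p := ⟨_, rfl⟩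
  obtain ⟨L, hL⟩ : ∃ L, L = height f p := ⟨_, rfl⟩
  have hgu : g u = p := by rw [hg, update_self]
  have hgne : ∀ x, x ≠ u → g x = f x := fun x hx => by rw [hg, update_of_ne hx]
  have hnot : ∀ j < L, f^[j] p ∉ periodicPts f := fun j hj =>
    iterate_notMem_of_lt_height (hL ▸ hj)
  have hneu : ∀ j < L, f^[j] p ≠ u := fun j hj h => hnot j hj (h ▸ hu)
  have hpath : ∀ j ≤ L, g^[j] p = f^[j] p := fun j hj => by
    rw [hg]
    exact iterate_update fun k hk => hneu k (by omega)
  have hroot : f^[L] p = root f p := by rw [hL, root]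
  have hrmem : root f p ∈ periodicPts f := root_mem_periodicPts f p
  have hfmem : ∀ x ∈ periodicPts f, f x ∈ periodicPts f := fun x hx => iterate_mem_periodicPts hx 1
  have hinj : InjOn f (periodicPts f) := (bijOn_periodicPts f).injOn
  rw [← hg] at hS hdom ⊢
  rw [← hL] at hp ⊢
  -- On this `g`-invariant set only `root f p` can have two preimages, so every nonperiodic point of
  -- it has that root.
  let F : Set V := periodicPts f ∪ {x | ∃ j < L, f^[j] p = x}
  have hF : MapsTo g F F := by
    rintro x (hx | ⟨j, hj, rfl⟩)
    · by_cases hxu : x = u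
      · exact Or.inr ⟨0, hp, by rw [hxu, hgu, iterate_zero_apply]⟩
      · rw [hgne x hxu]
        exact Or.inl (hfmem x hx)
    · rw [hgne _ (hneu j hj), ← iterate_succ_apply' f]
      rcases Nat.lt_or_ge (j + 1) L with h1 | h1
      · exact Or.inr ⟨j + 1, h1, rfl⟩
      · rw [show j.succ = L by omega, hroot]
        exact Or.inl hrmem
  have hfp : ∀ z ∈ F, f z ≠ p := by
    rintro z (hz | ⟨j, hj, rfl⟩) hzp
    · exact hnot 0 hp (by rw [iterate_zero_apply, ← hzp]; exact hfmem z hz)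
    · refine hnot 0 hp ⟨j + 1, j.succ_pos, ?_⟩
      change f^[j + 1] p = p
      rw [iterate_succ_apply', hzp]
  have hmix : ∀ w ∈ periodicPts f, ∀ j < L, f w = f (f^[j] p) → f w = root f p := by
    intro w hw j hj hwj
    have h1 : f^[j + 1] p ∈ periodicPts f := by
      rw [iterate_succ_apply', ← hwj]
      exact hfmem w hw
    have h2 : j + 1 = L := by
      by_contra hne
      exact hnot (j + 1) (by omega) h1
    rw [hwj, ← iterate_succ_apply' f, Nat.succ_eq_add_one, h2, hroot]
  have hheight : ∀ i, height f (f^[i] p) = L - i := fun i => by rw [height_iterate, hL]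
  have hcoll : ∀ w ∈ F, ∀ z ∈ F, w ≠ z → g w = g z → g w = root f p := by
    intro w hw z hz hwz hgwz
    by_cases hwu : w = u
    · rw [hwu, hgu, hgne z (fun h => hwz (hwu.trans h.symm))] at hgwz
      exact absurd hgwz.symm (hfp z hz)
    by_cases hzu : z = u
    · rw [hzu, hgu, hgne w hwu] at hgwz
      exact absurd hgwz (hfp w hw)
    rw [hgne w hwu, hgne z hzu] at hgwz
    rw [hgne w hwu]
    rcases hw with hw | ⟨i, hi, rfl⟩ <;> rcases hz with hz | ⟨j, hj, rfl⟩
    · exact absurd (hinj hw hz hgwz) hwz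
    · exact hmix w hw j hj hgwz
    · rw [hgwz]
      exact hmix z hz i hi hgwz.symm
    · rw [← iterate_succ_apply' f, ← iterate_succ_apply' f] at hgwz
      have := congrArg (height f) hgwz
      rw [hheight, hheight] at this
      exact absurd (by rw [show i = j by omega]) hwz
  have hrootF : ∀ x ∈ F, x ∉ periodicPts g → root g x = root f p := fun x hx hxg =>
    root_eq_of_collision hF hcoll hx hxg
  -- Within `L` steps every point enters a cycle of `f`, hence `F`, before `u` can interfere; so
  -- points of `g`-height above `L` would form a dominant tree.
  have hle : ∀ v, height g v ≤ L := by
    by_contra! hlt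
    refine hdom ⟨L, root f p, hlt, fun v hv => ?_⟩
    have hvL : height f v ≤ L := hL ▸ h.height_le f h.mem rfl v
    have hfg : g^[height f v] v = f^[height f v] v := by
      rw [hg]
      exact iterate_update fun k hk h => iterate_notMem_of_lt_height hk (h ▸ hu)
    rw [← root_iterate (n := height f v) (by omega)]
    refine hrootF _ (Or.inl ?_) (iterate_notMem_of_lt_height (by omega))
    rw [hfg]
    exact root_mem_periodicPts f v
  have hug : u ∈ periodicPts g := by
    by_contra hug
    have h1 := height_apply hug
    have h2 := root_apply hug
    have h3 := hle u
    rw [hgu] at h1 h2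
    rw [hrootF u (Or.inl hu) hug, root, hpath _ (by omega)] at h2
    exact hnot (height g p) (by omega) (h2 ▸ hrmem)
  have hpg : ∀ j < L, f^[j] p ∈ periodicPts g := fun j hj => by
    rw [← hpath j hj.le, ← hgu, ← iterate_succ_apply g]
    exact iterate_mem_periodicPts hug _
  -- The redirection gains the `L` cycle points `P` and loses at most the points `A`. The maximal
  -- cycle count then forces `height g (f u)` to be at least `L`.
  let A : Set V := (fun i => g^[i] (f u)) '' Iio (height g (f u))
  let P : Set V := (fun j => f^[j] p) '' Iio L
  have hPg : P ⊆ periodicPts g := by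
    rintro _ ⟨j, hj, rfl⟩
    exact hpg j hj
  have hPcard : P.ncard = L := by
    rw [InjOn.ncard_image, ncard_Iio_nat]
    intro i hi j hj hij
    have := congrArg (height f) hij
    simp only [hheight, mem_Iio] at this hi hj
    omega
  have hAcard : A.ncard ≤ height g (f u) :=
    (ncard_image_le (finite_Iio _)).trans (ncard_Iio_nat _).le
  have hsub : periodicPts f ⊆ (periodicPts g \ P) ∪ A := by
    intro x hx
    by_cases hxg : x ∈ periodicPts g
    · refine Or.inl ⟨hxg, ?_⟩
      rintro ⟨j, hj, rfl⟩
      exact hnot j hj hx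
    · obtain ⟨b, hb, -⟩ := exists_iterate_update_apply_eq hx (hg ▸ hxg)
      rw [← hg] at hb
      refine Or.inr ⟨b, ?_, hb⟩
      rw [mem_Iio, ← not_le, ← iterate_mem_iff, hb]
      exact hxg
  have hcard1 := (ncard_le_ncard hsub).trans (ncard_union_le _ _)
  have hcard2 := ncard_sdiff_add_ncard_of_subset hPg
  have hcard3 := h.ncard_le g hS
  have hqle := hle (f u)
  have hq : height g (f u) = L := by omega
  have hcard : (periodicPts g).ncard = (periodicPts f).ncard := by omega
  have hiter : ∀ i ≤ L, g^[i] (f u) = f^[i] (f u) := by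
    intro i hi
    rw [hg]
    refine iterate_update fun k hk hku => ?_
    obtain ⟨k', hk', hmin, heq⟩ := exists_iterate_update_eq p ⟨k, hku⟩
    have hkk : k' ≤ k := by
      by_contra! hlt
      exact hmin k hlt hku
    have h1 : g^[k'] (f u) ∉ periodicPts g := iterate_notMem_of_lt_height (by omega)
    rw [hg, heq k' le_rfl, hk', ← hg] at h1
    exact h1 hug
  have hqroot : root g (f u) = root f p :=
    hrootF _ (Or.inl (hfmem u hu)) (height_pos_iff.1 (by omega))
  refine ⟨?_, ⟨hS, fun k hk => hcard ▸ h.ncard_le k hk, fun k hk hkc x => ?_⟩, hq, hqroot, hiter⟩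
  · rw [← hiter L le_rfl, ← hqroot, root, hq]
  · rw [hq, hL]
    exact h.height_le k hk (hkc.trans hcard) x

/-! ### Selections of one edge per vertex. -/

variable {K : Type*}

/-- The functions which select one outgoing edge at each vertex. -/
def selections (t : V → K → V) : Set (V → V) := {f | ∀ v, ∃ k, t v k = f v}

theorem update_mem_selections {t : V → K → V} {f : V → V} (hf : f ∈ selections t) (v : V) (k : K) :
    update f v (t v k) ∈ selections t := by
  intro w
  by_cases hw : w = v
  · subst hw
    exact ⟨k, by rw [update_self]⟩
  · rw [update_of_ne hw]
    exact hf w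

/-- If no selection has a dominant tree, then in the extremal case all edges from the last vertex
before the root of `p` end in this root. -/
theorem IsExtremal.eq_root [Finite V] {t : V → K → V} {f : V → V} {p u : V} {l : K}
    (h : IsExtremal (selections t) f p) (hp : 0 < height f p) (hu : t u l = p)
    (hdom : ∀ g ∈ selections t, ¬ HasDominantTree g) (k : K) :
    t (f^[height f p - 1] p) k = root f p := by
  obtain ⟨L, hL⟩ : ∃ L, L = height f p := ⟨_, rfl⟩
  obtain ⟨v, hv⟩ : ∃ v, v = f^[L - 1] p := ⟨_, rfl⟩
  obtain ⟨s, hs⟩ : ∃ s, s = t v k := ⟨_, rfl⟩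
  obtain ⟨g, hg⟩ : ∃ g, g = update f v s := ⟨_, rfl⟩
  have hgS : g ∈ selections t := by
    rw [hg, hs]
    exact update_mem_selections h.mem v k
  have hS : ∀ f' ∈ selections t, update f' u p ∈ selections t := fun f' hf' =>
    hu ▸ update_mem_selections hf' u l
  have hvp : v ∉ periodicPts f := hv ▸ iterate_notMem_of_lt_height (by omega)
  have heq : periodicPts f = periodicPts g := hg ▸ h.periodicPts_update_eq hvp (hg ▸ hgS)
  have hgv : g v = s := by rw [hg, update_self]
  have hpath : g^[L - 1] p = v := by
    rw [hg, hv]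
    refine iterate_update fun j hj hne => ?_
    have := congrArg (height f) hne
    rw [height_iterate, height_iterate] at this
    omega
  have h1 := height_iterate g p (L - 1)
  have h2 := height_apply (heq ▸ hvp)
  have h3 := h.height_le g hgS (by rw [heq]) p
  rw [hpath] at h1
  rw [hgv] at h2
  have hgp : height g p = L := by omega
  have hgroot : root g p = s := by
    rw [root, hgp, show L = (L - 1) + 1 by omega, iterate_succ_apply', hpath, hgv]
  have hext : IsExtremal (selections t) g p :=
    ⟨hgS, fun f' hf' => heq ▸ h.ncard_le f' hf', fun f' hf' hc x => by
      rw [hgp, hL]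
      exact h.height_le f' hf' (hc.trans (by rw [heq])) x⟩
  have hup := h.mem_periodicPts_of_update_mem (hS f h.mem)
  have h4 := (h.mirror hp (hS f h.mem) (hdom _ (hS f h.mem))).1
  have h5 := (hext.mirror (by omega) (hS g hgS) (hdom _ (hS g hgS))).1
  -- By `mirror`, each root is `L + 1` steps after `u`; the orbit of `u` is periodic and avoids `v`,
  -- so both maps give the same root.
  have h6 : g^[L + 1] u = f^[L + 1] u := by
    rw [hg]
    refine iterate_update fun j _ hj => hvp ?_
    rw [← hj]
    exact iterate_mem_periodicPts hup j
  rw [hgp, hgroot, ← iterate_succ_apply g, Nat.succ_eq_add_one, h6, iterate_succ_apply, hL, h4] at h5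
  rw [← hL, ← hv, ← hs, h5]

/-- A graph in which no two vertices send all their edges to the same vertex, and in which some
vertex sends its edges to at least two vertices, has a selection with a dominant tree. -/
theorem exists_hasDominantTree [Finite V] [Nonempty K] {t : V → K → V}
    (hin : ∀ p, ∃ u k, t u k = p) (hbunch : ∃ v k l, t v k ≠ t v l)
    (hne : ∀ v w, (∀ k l, t v k = t w l) → v = w) :
    ∃ f ∈ selections t, HasDominantTree f := by
  by_contra! hdom
  obtain ⟨v, k, l, hvkl⟩ := hbunch
  have : Nonempty V := ⟨v⟩
  obtain ⟨f, p, h⟩ := exists_isExtremal (S := selections t)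
    ⟨fun v => t v (Classical.arbitrary K), fun v => ⟨_, rfl⟩⟩
  rcases Nat.eq_zero_or_pos (height f p) with hp | hp
  · have hinj : Injective f := by
      rw [injective_iff_periodicPts_eq_univ, eq_univ_iff_forall]
      exact fun v => height_eq_zero_iff.1 (Nat.le_zero.1 (hp ▸ h.height_le f h.mem rfl v))
    obtain ⟨m, hm⟩ : ∃ m, t v m ≠ f v := by
      by_contra! hall
      exact hvkl ((hall k).trans (hall l).symm)
    exact hdom _ (update_mem_selections h.mem v m) (hasDominantTree_update_of_injective hinj hm)
  · obtain ⟨u, m, hu⟩ := hin p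
    have hS : update f u p ∈ selections t := hu ▸ update_mem_selections h.mem u m
    have hup := h.mem_periodicPts_of_update_mem hS
    obtain ⟨-, hext, hheight, hroot, hiter⟩ := h.mirror hp hS (hdom _ hS)
    have h1 := h.eq_root hp hu hdom
    -- In the mirror picture `f u` plays the role of `p`, reached from `u` by the edge that `f`
    -- selects.
    have h2 := hext.eq_root (hheight ▸ hp) (l := (h.mem u).choose) (h.mem u).choose_spec hdom
    rw [hheight, hroot, hiter _ (by omega)] at h2
    refine iterate_notMem_of_lt_height (f := f) (x := p) (n := height f p - 1) (by omega) ?_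
    rw [hne _ _ fun k l => (h1 k).trans (h2 l).symm]
    exact iterate_mem_periodicPts (iterate_mem_periodicPts hup 1) _

end Functional

/-! ### Stable pairs and synchronization in automata. -/

section Automata

variable {V K : Type*}

/-- Some word leads `u` and `v` to the same state. -/
def Sync (δ : V → K → V) (u v : V) : Prop := ∃ w : List K, w.foldl δ u = w.foldl δ v

/-- Whatever word is read from `u` and `v`, the states reached can be synchronized. -/
def Stable (δ : V → K → V) (u v : V) : Prop :=
  ∀ w : List K, Sync δ (w.foldl δ u) (w.foldl δ v)

/-- Every state can be reached from every state. -/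
def Connected (δ : V → K → V) : Prop := ∀ u v, ∃ w : List K, w.foldl δ u = v

/-- The automaton obtained by permuting the labels at each state. -/
def recolor (t : V → K → V) (σ : V → Equiv.Perm K) : V → K → V := fun v k => t v (σ v k)

theorem Stable.sync {δ : V → K → V} {u v : V} (h : Stable δ u v) : Sync δ u v := h []

theorem Stable.foldl {δ : V → K → V} {u v : V} (h : Stable δ u v) (w : List K) :
    Stable δ (w.foldl δ u) (w.foldl δ v) := fun w' => by
  rw [← List.foldl_append, ← List.foldl_append]
  exact h (w ++ w')

/-- Stability is an equivalence relation. -/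
def stableSetoid (δ : V → K → V) : Setoid V where
  r := Stable δ
  iseqv :=
    { refl := fun _ _ => ⟨[], rfl⟩
      symm := fun h w => (h w).imp fun _ h => h.symm
      trans := fun {x y z} hxy hyz w => by
        obtain ⟨w₁, h₁⟩ := hxy w
        obtain ⟨w₂, h₂⟩ := hyz (w ++ w₁)
        refine ⟨w₁ ++ w₂, ?_⟩
        simp only [List.foldl_append] at h₂ ⊢
        rw [h₁, h₂] }

theorem Connected.recolor {t : V → K → V} (h : Connected t) (σ : V → Equiv.Perm K) :
    Connected (recolor t σ) := by
  intro u v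
  obtain ⟨w, hw⟩ := h u v
  induction w generalizing u with
  | nil => exact ⟨[], hw⟩
  | cons k w ih =>
    obtain ⟨w', hw'⟩ := ih (t u k) hw
    refine ⟨(σ u).symm k :: w', ?_⟩
    rw [List.foldl_cons, RoadColoring.recolor, Equiv.apply_symm_apply]
    exact hw'

theorem foldl_replicate (δ : V → K → V) (k : K) (n : ℕ) (v : V) :
    (List.replicate n k).foldl δ v = (fun v => δ v k)^[n] v := by
  induction n generalizing v with
  | zero => rfl
  | succ n ih => rw [List.replicate_succ, List.foldl_cons, ih, iterate_succ_apply]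

section Images

variable [Fintype V] [DecidableEq V]

/-- The set of states reached by reading the word `w`. -/
def wordImage (δ : V → K → V) (w : List K) : Finset V := Finset.univ.image (w.foldl δ)

theorem wordImage_append (δ : V → K → V) (w w' : List K) :
    wordImage δ (w ++ w') = (wordImage δ w).image (w'.foldl δ) := by
  rw [wordImage, wordImage, Finset.image_image]
  congr 1
  funext v
  exact List.foldl_append

theorem image_foldl_wordImage_subset (δ : V → K → V) (w w' : List K) (I : Finset V) :
    I.image ((w' ++ w).foldl δ) ⊆ wordImage δ w := by
  intro x hx
  obtain ⟨y, -, rfl⟩ := Finset.mem_image.1 hx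
  rw [List.foldl_append]
  exact Finset.mem_image_of_mem _ (Finset.mem_univ _)

/-- Two minimal images which differ in a single element give a stable pair. -/
theorem stable_of_wordImage_eq_insert {δ : V → K → V} {w₁ w₂ : List K} {C : Finset V} {x y : V}
    (hmin : ∀ w, C.card + 1 ≤ (wordImage δ w).card)
    (hw₁ : wordImage δ w₁ = insert x C) (hw₂ : wordImage δ w₂ = insert y C) :
    Stable δ x y := by
  intro u
  obtain ⟨w, hw⟩ : ∃ w, (wordImage δ w).card = C.card + 1 :=
    ⟨w₁, le_antisymm (hw₁ ▸ Finset.card_insert_le _ _) (hmin _)⟩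
  -- Reading `u ++ w` maps both minimal images onto `wordImage δ w`, so `x` and `y` both go to the
  -- one element outside the image of `C`.
  refine ⟨w, ?_⟩
  rw [← List.foldl_append, ← List.foldl_append]
  have key : ∀ w' z, wordImage δ w' = insert z C →
      insert ((u ++ w).foldl δ z) (C.image ((u ++ w).foldl δ)) = wordImage δ w := by
    intro w' z hz
    refine (Finset.image_insert _ _ _).symm.trans ?_
    refine Finset.eq_of_subset_of_card_le (image_foldl_wordImage_subset δ w u _) ?_
    rw [hw, ← hz, ← wordImage_append]
    exact hmin _
  have hx := key w₁ x hw₁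
  have hy := key w₂ y hw₂
  have hxC : (u ++ w).foldl δ x ∉ C.image ((u ++ w).foldl δ) := by
    intro hmem
    rw [Finset.insert_eq_of_mem hmem] at hx
    have := Finset.card_image_le (s := C) (f := (u ++ w).foldl δ)
    rw [hx] at this
    omega
  have : (u ++ w).foldl δ x ∈ insert ((u ++ w).foldl δ y) (C.image ((u ++ w).foldl δ)) := by
    rw [hy, ← hx]
    exact Finset.mem_insert_self _ _
  exact (Finset.mem_insert.1 this).resolve_right hxC

end Images

/-- A letter which acts with a dominant tree yields a pair of distinct stable states. -/
theorem exists_stable_of_hasDominantTree [Finite V] {δ : V → K → V} (hδ : Connected δ) (k : K)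
    (hdom : HasDominantTree fun v => δ v k) : ∃ x y, x ≠ y ∧ Stable δ x y := by
  classical
  have := Fintype.ofFinite V
  obtain ⟨f, hf⟩ : ∃ f : V → V, f = fun v => δ v k := ⟨_, rfl⟩
  rw [← hf] at hdom
  obtain ⟨L, r, ⟨v, hv⟩, hr⟩ := hdom
  have : Nonempty V := ⟨v⟩
  obtain ⟨x, hx⟩ := Finite.exists_max (height f)
  obtain ⟨M, hM⟩ : ∃ M, M = height f x := ⟨_, rfl⟩
  have hLM : L < M := by
    have := hx v
    omega
  have hword : ∀ (w : List K) (n : ℕ), wordImage δ (w ++ List.replicate n k) =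
      (wordImage δ w).image f^[n] := fun w n => by
    rw [wordImage_append, hf]
    congr 1
    funext v
    exact foldl_replicate δ k n v
  obtain ⟨w₀, hw₀⟩ : ∃ w₀, ∀ w, (wordImage δ w₀).card ≤ (wordImage δ w).card :=
    ⟨_, fun w => argmin_le (fun w => (wordImage δ w).card) w⟩
  obtain ⟨w, hwx, hw⟩ : ∃ w, x ∈ wordImage δ w ∧
      ∀ w', (wordImage δ w).card ≤ (wordImage δ w').card := by
    obtain ⟨w₁, hw₁⟩ := hδ (w₀.foldl δ x) x
    refine ⟨w₀ ++ w₁, Finset.mem_image.2 ⟨x, Finset.mem_univ _, by rw [List.foldl_append, hw₁]⟩,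
      fun w' => le_trans ?_ (hw₀ w')⟩
    rw [wordImage_append]
    exact Finset.card_image_le
  obtain ⟨I, hI⟩ : ∃ I, I = wordImage δ w := ⟨_, rfl⟩
  rw [← hI] at hw hwx
  have hinj : Set.InjOn f^[M] I := by
    refine Finset.card_image_iff.1 (le_antisymm Finset.card_image_le ?_)
    rw [hI, ← hword, ← hI]
    exact hw _
  -- Another point of height `M` in `I` would share its root with `x`, against injectivity of
  -- `f^[M]` on the minimal image.
  have hlow : ∀ y ∈ I.erase x, f^[M - 1] y ∈ periodicPts f := by
    intro y hy
    rw [iterate_mem_iff]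
    by_contra! hlt
    have hyM : height f y = M := by
      have := hx y
      omega
    refine (Finset.mem_erase.1 hy).1 (hinj (Finset.mem_erase.1 hy).2 hwx ?_)
    have h1 := hr y (by omega)
    have h2 := hr x (by omega)
    rw [root, hyM] at h1
    rw [root, ← hM] at h2
    rw [h1, h2]
  -- A common multiple of all cycle lengths: `T` more steps fix `C` but move the nonperiodic point
  -- `f^[M - 1] x` onto a cycle.
  obtain ⟨T, hT⟩ : ∃ T, T = (Fintype.card V).factorial := ⟨_, rfl⟩
  have hTpos : 0 < T := hT ▸ Nat.factorial_pos _
  have hper : ∀ z ∈ periodicPts f, f^[T] z = z := fun z hz => by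
    rw [hT]
    exact isPeriodicPt_factorial_card_of_mem_periodicPts hz
  obtain ⟨C, hC⟩ : ∃ C, C = (I.erase x).image f^[M - 1] := ⟨_, rfl⟩
  have h1 : wordImage δ (w ++ List.replicate (M - 1) k) = insert (f^[M - 1] x) C := by
    rw [hword, ← hI, hC, ← Finset.image_insert, Finset.insert_erase hwx]
  have h2 : wordImage δ (w ++ List.replicate (M - 1) k ++ List.replicate T k) =
      insert (f^[T] (f^[M - 1] x)) C := by
    rw [hword, h1, Finset.image_insert]
    congr 1
    conv_rhs => rw [← Finset.image_id (s := C)]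
    refine Finset.image_congr fun z hz => ?_
    rw [hC, Finset.mem_coe, Finset.mem_image] at hz
    obtain ⟨y, hy, rfl⟩ := hz
    exact hper _ (hlow y hy)
  refine ⟨_, _, fun heq => ?_, stable_of_wordImage_eq_insert (fun w' => ?_) h1 h2⟩
  · refine iterate_notMem_of_lt_height (f := f) (x := x) (n := M - 1) (by omega) ?_
    rw [heq, ← iterate_add_apply, iterate_mem_iff]
    omega
  · refine le_trans ?_ (hw w')
    rw [hC, ← Finset.card_erase_add_one hwx]
    exact Nat.succ_le_succ Finset.card_image_le

/-- Either all edges of a strongly connected graph are determined up to multiplicity by their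
origin, or some recoloring has a nontrivial stable pair. -/
theorem exists_recolor_stable [Finite V] [Nonempty K] {t : V → K → V} (ht : Connected t)
    (hbunch : ∃ v k l, t v k ≠ t v l) :
    ∃ σ x y, x ≠ y ∧ Stable (recolor t σ) x y := by
  classical
  by_cases hne : ∀ v w, (∀ k l, t v k = t w l) → v = w
  · have hin : ∀ p, ∃ u k, t u k = p := by
      intro p
      obtain ⟨v, k, -⟩ := hbunch
      obtain ⟨w, hw⟩ := ht (t v k) p
      rcases List.eq_nil_or_concat w with rfl | ⟨w, l, rfl⟩
      · exact ⟨v, k, hw⟩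
      · exact ⟨w.foldl t (t v k), l, by simpa using hw⟩
    obtain ⟨f, hf, hdom⟩ := exists_hasDominantTree hin hbunch hne
    choose κ hκ using hf
    let k := Classical.arbitrary K
    obtain ⟨x, y, hxy, h⟩ := exists_stable_of_hasDominantTree
      (ht.recolor fun v => Equiv.swap k (κ v)) k (by
        simpa only [recolor, Equiv.swap_apply_left, hκ] using hdom)
    exact ⟨_, x, y, hxy, h⟩
  -- Two vertices whose edges all share one end are merged by any letter.
  · push Not at hne
    obtain ⟨x, y, h, hxy⟩ := hne
    refine ⟨fun _ => 1, x, y, hxy, fun w => ?_⟩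
    cases w with
    | nil => exact ⟨[Classical.arbitrary K], h _ _⟩
    | cons k w => exact ⟨[], congrArg (fun z => List.foldl _ z w) (h k k)⟩

/-- A connected graph in which all edges with the same origin have the same end is a cycle. -/
theorem exists_cyclic_labelling [Finite V] [Nonempty V] [Nonempty K] {t : V → K → V}
    (ht : Connected t) (hbunch : ∀ v k l, t v k = t v l) :
    ∃ (n : ℕ) (h : V → ZMod n), 0 < n ∧ (∀ v k, h (t v k) = h v + 1) ∧ Injective h := by
  let x := Classical.arbitrary V
  let k := Classical.arbitrary K
  obtain ⟨f, hf⟩ : ∃ f : V → V, f = fun v => t v k := ⟨_, rfl⟩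
  have htf : ∀ v l, t v l = f v := fun v l => by rw [hf, hbunch v l k]
  have hreach : ∀ u v, ∃ j, f^[j] u = v := by
    intro u v
    obtain ⟨w, hw⟩ := ht u v
    induction w generalizing u with
    | nil => exact ⟨0, hw⟩
    | cons l w ih =>
      obtain ⟨j, hj⟩ := ih (t u l) hw
      exact ⟨j + 1, by rw [iterate_succ_apply, ← htf u l, hj]⟩
  have hx : x ∈ periodicPts f := by
    obtain ⟨j, hj⟩ := hreach (f x) x
    exact ⟨j + 1, j.succ_pos, hj⟩
  have hn := minimalPeriod_pos_of_mem_periodicPts hx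
  choose j hj using hreach x
  refine ⟨minimalPeriod f x, fun v => (j v : ZMod _), hn, fun v l => ?_, fun u v huv => ?_⟩
  · have h1 : f^[j (t v l)] x = f^[j v + 1] x := by
      rw [hj, iterate_succ_apply', hj, htf]
    rw [← Nat.cast_add_one, ZMod.natCast_eq_natCast_iff]
    rw [← iterate_mod_minimalPeriod_eq, ← iterate_mod_minimalPeriod_eq (n := j v + 1)] at h1
    exact (iterate_eq_iterate_iff_of_lt_minimalPeriod (Nat.mod_lt _ hn) (Nat.mod_lt _ hn)).1 h1
  · have h1 : j u % minimalPeriod f x = j v % minimalPeriod f x :=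
      (ZMod.natCast_eq_natCast_iff _ _ _).1 huv
    rw [← hj u, ← hj v, ← iterate_mod_minimalPeriod_eq, h1, iterate_mod_minimalPeriod_eq]

theorem foldl_semiconj {W : Type*} {δ : V → K → V} {δ' : W → K → W} {π : V → W}
    (h : ∀ v k, π (δ v k) = δ' (π v) k) (w : List K) (v : V) :
    π (w.foldl δ v) = w.foldl δ' (π v) := by
  induction w generalizing v with
  | nil => rfl
  | cons k w ih => rw [List.foldl_cons, List.foldl_cons, ih, h]

/-- Synchronization survives a recoloring which permutes the labels in the same way at states with
the same image in the stable quotient. -/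
theorem sync_recolor_of_stable {W : Type*} {δ : V → K → V} {π : V → W}
    (hπ : ∀ u v, π u = π v ↔ Stable δ u v) (τ : W → Equiv.Perm K) {u v : V} (h : π u = π v) :
    Sync (recolor δ fun x => τ (π x)) u v := by
  obtain ⟨w, hw⟩ := ((hπ u v).1 h).sync
  induction w generalizing u v with
  | nil => exact ⟨[], hw⟩
  | cons k w ih =>
    -- Stability keeps both states in one class, where `τ` acts alike, so the merging word of `δ` is
    -- translated letter by letter for both.
    obtain ⟨w', hw'⟩ := ih ((hπ _ _).2 (((hπ u v).1 h).foldl [k])) hw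
    refine ⟨(τ (π u)).symm k :: w', ?_⟩
    have hu : recolor δ (fun x => τ (π x)) u ((τ (π u)).symm k) = δ u k := by
      rw [recolor, Equiv.apply_symm_apply]
    have hv : recolor δ (fun x => τ (π x)) v ((τ (π u)).symm k) = δ v k := by
      rw [recolor, h, Equiv.apply_symm_apply]
    rw [List.foldl_cons, List.foldl_cons, hu, hv]
    exact hw'

/-- The periodic road coloring theorem, for pairs of states. -/
theorem exists_recolor_sync [Finite V] [Nonempty V] [Nonempty K] {t : V → K → V}
    (ht : Connected t) :
    ∃ (σ : V → Equiv.Perm K) (n : ℕ) (h : V → ZMod n), 0 < n ∧ (∀ v k, h (t v k) = h v + 1) ∧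
      ∀ u v, h u = h v → Sync (recolor t σ) u v := by
  induction hN : Nat.card V using Nat.strong_induction_on generalizing V with
  | _ N ih =>
  by_cases hbunch : ∃ v k l, t v k ≠ t v l
  · obtain ⟨σ, x, y, hxy, hst⟩ := exists_recolor_stable ht hbunch
    have hquot : ∀ k u v, Stable (recolor t σ) u v →
        Stable (recolor t σ) (recolor t σ u k) (recolor t σ v k) := fun k u v h => h.foldl [k]
    let s := stableSetoid (recolor t σ)
    let t' : Quotient s → K → Quotient s := fun q k =>
      Quotient.map (fun v => recolor t σ v k) (fun u v h => hquot k u v h) q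
    let π : V → Quotient s := Quotient.mk s
    have hπ : ∀ u v, π u = π v ↔ Stable (recolor t σ) u v := fun u v => Quotient.eq
    have hπt : ∀ v k, π (recolor t σ v k) = t' (π v) k := fun _ _ => rfl
    have hlt : Nat.card (Quotient s) < N := by
      rw [← hN]
      by_contra! hle
      have hbij := (Quotient.mk_surjective (s := s)).bijective_of_nat_card_le hle
      exact hxy (hbij.1 ((hπ x y).2 hst))
    have ht' : Connected t' := by
      intro a b
      obtain ⟨u, rfl⟩ := Quotient.mk_surjective a
      obtain ⟨v, rfl⟩ := Quotient.mk_surjective b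
      obtain ⟨w, hw⟩ := ht.recolor σ u v
      exact ⟨w, by rw [← hw]; exact (foldl_semiconj hπt w u).symm⟩
    have : Nonempty (Quotient s) := ⟨π x⟩
    obtain ⟨τ, n, h, hn, hstep, hsync⟩ := ih _ hlt ht' rfl
    have hrec : (recolor t fun v => (τ (π v)).trans (σ v)) =
        recolor (recolor t σ) fun v => τ (π v) := rfl
    refine ⟨fun v => (τ (π v)).trans (σ v), n, h ∘ π, hn, fun v k => ?_, fun u v huv => ?_⟩
    · have := hstep (π v) ((σ v).symm k)
      rwa [← hπt, recolor, Equiv.apply_symm_apply] at this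
    · rw [hrec]
      obtain ⟨w, hw⟩ := hsync _ _ huv
      have hsemi := foldl_semiconj (δ := recolor (recolor t σ) fun v => τ (π v))
        (δ' := recolor t' τ) (π := π) (fun v k => hπt v _) w
      rw [← hsemi, ← hsemi] at hw
      obtain ⟨w', hw'⟩ := sync_recolor_of_stable hπ τ hw
      exact ⟨w ++ w', by rw [List.foldl_append, List.foldl_append, hw']⟩
  · push Not at hbunch
    obtain ⟨n, h, hn, hstep, hinj⟩ := exists_cyclic_labelling ht hbunch
    exact ⟨fun _ => 1, n, h, hn, hstep, fun u v huv => ⟨[], hinj huv⟩⟩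

/-- If the classes of a labelling which advances with each letter can be synchronized pairwise,
they can be synchronized simultaneously. -/
theorem exists_word_of_sync [Finite V] {δ : V → K → V} {n : ℕ} {h : V → ZMod n}
    (hstep : ∀ v k, h (δ v k) = h v + 1) (hsync : ∀ u v, h u = h v → Sync δ u v) :
    ∃ w : List K, ∀ u v, h u = h v → w.foldl δ u = w.foldl δ v := by
  have hfold : ∀ (w : List K) u v, h u = h v → h (w.foldl δ u) = h (w.foldl δ v) := by
    intro w
    induction w with
    | nil => exact fun u v huv => huv
    | cons k w ih => exact fun u v huv => ih _ _ (by rw [hstep, hstep, huv])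
  suffices ∀ P : Set (V × V), P.Finite →
      ∃ w : List K, ∀ u v, (u, v) ∈ P → h u = h v → w.foldl δ u = w.foldl δ v by
    obtain ⟨w, hw⟩ := this univ finite_univ
    exact ⟨w, fun u v => hw u v trivial⟩
  intro P hP
  induction P, hP using Set.Finite.induction_on with
  | empty => exact ⟨[], fun _ _ h => h.elim⟩
  | @insert a P _ _ ih =>
    obtain ⟨w, hw⟩ := ih
    by_cases ha : h a.1 = h a.2
    · obtain ⟨w', hw'⟩ := hsync _ _ (hfold w _ _ ha)
      refine ⟨w ++ w', fun u v huv he => ?_⟩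
      rw [List.foldl_append, List.foldl_append]
      rcases huv with rfl | huv
      · exact hw'
      · rw [hw u v huv he]
    · refine ⟨w, fun u v huv he => ?_⟩
      rcases huv with rfl | huv
      · exact absurd he ha
      · exact hw u v huv he

end Automata

/-! ### Back to graphs: backward automata and cyclic components. -/

open DirectedGraph

section Graphs

variable {V E : Type*} {G : DirectedGraph V E} {d p : ℕ}

/-- `ε v k` is the unique edge with range `v` and color `k`. -/
structure IsEdgeSelection (G : DirectedGraph V E) (c : E → Fin d) (ε : V → Fin d → E) : Prop where
  r_eq : ∀ v k, G.r (ε v k) = v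
  color_eq : ∀ v k, c (ε v k) = k
  eq_self : ∀ e, ε (G.r e) (c e) = e

theorem exists_isEdgeSelection [Finite E] (hreg : G.InDegreeRegular d) {c : E → Fin d}
    (hc : G.IsStrongEdgeColoring c) : ∃ ε, IsEdgeSelection G c ε := by
  have hinj : ∀ v, Injective fun e : {e : E // G.r e = v} => c e := fun v e f hef => by
    by_contra hne
    exact hc e f (fun h => hne (Subtype.ext h)) (e.2.trans f.2.symm) hef
  have hbij : ∀ v, Bijective fun e : {e : E // G.r e = v} => c e := fun v =>
    (hinj v).bijective_of_nat_card_le (by rw [hreg v, Nat.card_fin])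
  choose ε hε using fun v => (hbij v).2
  refine ⟨fun v k => ε v k, fun v k => (ε v k).2, hε, fun e => ?_⟩
  exact congrArg Subtype.val (hinj (G.r e) (hε (G.r e) (c e)) : ε (G.r e) (c e) = ⟨e, rfl⟩)

theorem exists_isStrongEdgeColoring [Finite E] (hreg : G.InDegreeRegular d) :
    ∃ c : E → Fin d, G.IsStrongEdgeColoring c := by
  have η : ∀ v, {e : E // G.r e = v} ≃ Fin d := fun v => Finite.equivFinOfCardEq (hreg v)
  refine ⟨fun e => η (G.r e) ⟨e, rfl⟩, fun e f hne hr hc => hne ?_⟩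
  have key : ∀ v (he : G.r e = v) (hf : G.r f = v), η v ⟨e, he⟩ = η v ⟨f, hf⟩ → e = f :=
    fun v he hf h => congrArg Subtype.val ((η v).injective h)
  refine key (G.r f) hr rfl (Eq.trans ?_ hc)
  have htr : ∀ v (he : G.r e = v), η v ⟨e, he⟩ = η (G.r e) ⟨e, rfl⟩ := by
    rintro v rfl
    rfl
  exact htr _ hr

/-- Reading the color `k` backward at `v`. -/
def backward (G : DirectedGraph V E) (ε : V → Fin d → E) (v : V) (k : Fin d) : V := G.s (ε v k)

theorem IsEdgeSelection.exists_isPath {c : E → Fin d} {ε : V → Fin d → E}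
    (h : IsEdgeSelection G c ε) (w : List (Fin d)) (v : V) :
    ∃ l, G.IsPath l v (w.foldl (backward G ε) v) ∧ l.map c = w := by
  induction w generalizing v with
  | nil => exact ⟨[], rfl, rfl⟩
  | cons k w ih =>
    obtain ⟨l, hl, hlw⟩ := ih (backward G ε v k)
    exact ⟨ε v k :: l, ⟨h.r_eq v k, hl⟩, by rw [List.map_cons, hlw, h.color_eq]⟩

theorem IsEdgeSelection.foldl_map {c : E → Fin d} {ε : V → Fin d → E}
    (h : IsEdgeSelection G c ε) {l : List E} {v w : V} (hl : G.IsPath l v w) :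
    (l.map c).foldl (backward G ε) v = w := by
  induction l generalizing v with
  | nil => exact hl
  | cons e l ih =>
    obtain ⟨rfl, hl⟩ := hl
    rw [List.map_cons, List.foldl_cons, backward, h.eq_self]
    exact ih hl

theorem IsEdgeSelection.connected {c : E → Fin d} {ε : V → Fin d → E}
    (h : IsEdgeSelection G c ε) (htrans : G.IsTransitive) : Connected (backward G ε) := fun u v => by
  obtain ⟨l, hl⟩ := htrans u v
  exact ⟨l.map c, h.foldl_map hl⟩

/-- Permuting the labels at each vertex corresponds to another strong edge coloring. -/
theorem IsEdgeSelection.recolor {c : E → Fin d} {ε : V → Fin d → E}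
    (h : IsEdgeSelection G c ε) (σ : V → Equiv.Perm (Fin d)) :
    IsEdgeSelection G (fun e => (σ (G.r e)).symm (c e)) fun v k => ε v (σ v k) where
  r_eq v k := h.r_eq _ _
  color_eq v k := by rw [h.r_eq, h.color_eq, Equiv.symm_apply_apply]
  eq_self e := by rw [Equiv.apply_symm_apply, h.eq_self]

theorem IsEdgeSelection.isStrongEdgeColoring {c : E → Fin d} {ε : V → Fin d → E}
    (h : IsEdgeSelection G c ε) : G.IsStrongEdgeColoring c := fun e f hne hr hc =>
  hne (by rw [← h.eq_self e, ← h.eq_self f, hr, hc])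

theorem exists_label {U : ZMod p → Set V} (hU : G.IsCyclicPartition p U) :
    ∃ g : V → ZMod p, (∀ v i, v ∈ U i ↔ g v = i) ∧ ∀ e, G.r e ∈ U (g (G.s e) + 1) := by
  have hex : ∀ v, ∃ i, v ∈ U i := fun v => mem_iUnion.1 (hU.cover ▸ mem_univ v)
  choose g hg using hex
  refine ⟨g, fun v i => ⟨fun hv => ?_, fun h => h ▸ hg v⟩, fun e => hU.edge e _ (hg _)⟩
  by_contra hne
  exact disjoint_left.1 (hU.disjoint _ _ hne) (hg v) hv

theorem label_foldl {ε : V → Fin d → E} (hε : ∀ v k, G.r (ε v k) = v) {g : V → ZMod p}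
    (hg : ∀ e, g (G.r e) = g (G.s e) + 1) (w : List (Fin d)) (v : V) :
    g (w.foldl (backward G ε) v) = g v - w.length := by
  induction w generalizing v with
  | nil => simp
  | cons k w ih =>
    have := hg (ε v k)
    rw [hε] at this
    rw [List.foldl_cons, ih, backward, this, List.length_cons, Nat.cast_add_one]
    ring

/-- The sign appears because `h` grows against the direction of the edges. -/
theorem isCyclicPartition_of_label {n : ℕ} (hn : 0 < n) {h : V → ZMod n} (hsurj : Surjective h)
    (hh : ∀ e, h (G.s e) = h (G.r e) + 1) : G.IsCyclicPartition n fun i => {v | h v = -i} where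
  pos := hn
  nonempty i := hsurj (-i)
  disjoint i j hij := disjoint_left.2 fun v hi hj =>
    hij (neg_injective (Eq.trans (Eq.symm hi) hj))
  cover := eq_univ_iff_forall.2 fun v => mem_iUnion.2 ⟨-h v, (neg_neg _).symm⟩
  edge e i hi := by
    have h1 : h (G.s e) = -i := hi
    rw [hh] at h1
    change h (G.r e) = -(i + 1)
    rw [neg_add, ← h1]
    ring

/-- The periodic road coloring theorem. -/
theorem exists_isSynchronizing [Finite V] [Finite E] (htrans : G.IsTransitive)
    (hreg : G.InDegreeRegular d) (hper : G.HasPeriod p) {U : ZMod p → Set V}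
    (hU : G.IsCyclicPartition p U) :
    ∃ c : E → Fin d, G.IsStrongEdgeColoring c ∧ G.IsSynchronizing c U := by
  obtain ⟨c₀, hc₀⟩ := exists_isStrongEdgeColoring hreg
  obtain ⟨ε₀, hε₀⟩ := exists_isEdgeSelection hreg hc₀
  rcases Nat.eq_zero_or_pos d with rfl | hd
  -- Without edges, transitivity leaves a single vertex and the empty word works.
  · choose x hx using hU.nonempty
    refine ⟨c₀, hc₀, x, [], hx, fun i v _ => ⟨[], ?_, rfl⟩⟩
    obtain ⟨l, hl⟩ := htrans v (x i)
    cases l with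
    | nil => exact hl
    | cons e l => exact (c₀ e).elim0
  have : Nonempty (Fin d) := ⟨⟨0, hd⟩⟩
  have : Nonempty V := ⟨(hU.nonempty 0).some⟩
  have : NeZero p := ⟨hU.pos.ne'⟩
  obtain ⟨σ, n, h, hn, hstep, hsync⟩ := exists_recolor_sync (hε₀.connected htrans)
  have : NeZero n := ⟨hn.ne'⟩
  have hε := hε₀.recolor σ
  obtain ⟨c, hc⟩ : ∃ c : E → Fin d, c = fun e => (σ (G.r e)).symm (c₀ e) := ⟨_, rfl⟩
  obtain ⟨ε, hεdef⟩ : ∃ ε : V → Fin d → E, ε = fun v k => ε₀ v (σ v k) := ⟨_, rfl⟩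
  have hrec : recolor (backward G ε₀) σ = backward G ε := by rw [hεdef]; rfl
  rw [← hc, ← hεdef] at hε
  rw [hrec] at hsync
  have hstep' : ∀ v k, h (backward G ε v k) = h v + 1 := fun v k => by
    rw [← hrec]
    exact hstep v _
  obtain ⟨γ, hγ⟩ := exists_word_of_sync hstep' hsync
  obtain ⟨g, hgU, hgedge⟩ := exists_label hU
  have hg : ∀ e, g (G.r e) = g (G.s e) + 1 := fun e => (hgU _ _).1 (hgedge e)
  have hh : ∀ e, h (G.s e) = h (G.r e) + 1 := fun e => by
    rw [← hstep' (G.r e) (c e), backward, hε.eq_self]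
  have hgfold := label_foldl hε.r_eq hg
  have hsurj : Surjective h := by
    let k := Classical.arbitrary (Fin d)
    let v := Classical.arbitrary V
    have hiter : ∀ j : ℕ, ∃ u, h u = h v + j := by
      intro j
      induction j with
      | zero => exact ⟨v, by simp⟩
      | succ j ih =>
        obtain ⟨u, hu⟩ := ih
        exact ⟨backward G ε u k, by rw [hstep', hu, Nat.cast_add_one, add_assoc]⟩
    intro i
    obtain ⟨u, hu⟩ := hiter (i - h v).val
    exact ⟨u, by rw [hu, ZMod.natCast_zmod_val, add_sub_cancel]⟩
  have hnp : n ≤ p := hper.2 ⟨_, isCyclicPartition_of_label hn hsurj hh⟩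
  -- A word shifts every `g`-label by the same amount, so states it merges had equal labels.
  have hhg : ∀ u v, h u = h v → g u = g v := fun u v huv => by
    have := congrArg g (hγ u v huv)
    rwa [hgfold, hgfold, sub_left_inj] at this
  -- `g` factors through a surjection from `ZMod n` to `ZMod p`, which is bijective since `n ≤ p`.
  have hgh : ∀ u v, g u = g v → h u = h v := by
    choose ψ hψ using hsurj
    have hφ : ∀ v, g (ψ (h v)) = g v := fun v => hhg _ _ (hψ _)
    have hφsurj : Surjective fun i => g (ψ i) := fun i => by
      obtain ⟨v, hv⟩ := hU.nonempty i
      exact ⟨h v, (hφ v).trans ((hgU v i).1 hv)⟩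
    have hφbij := hφsurj.bijective_of_nat_card_le (by rwa [Nat.card_zmod, Nat.card_zmod])
    exact fun u v huv => hφbij.1 ((hφ u).trans (huv.trans (hφ v).symm))
  -- Padding `γ` to length `p * γ.length` makes the paths end in the component where they start.
  let μ := γ ++ List.replicate ((p - 1) * γ.length) (Classical.arbitrary (Fin d))
  have hμlen : (μ.length : ZMod p) = 0 := by
    have hlen : μ.length = p * γ.length := by
      obtain ⟨q, rfl⟩ := Nat.exists_eq_add_of_le' hU.pos
      simp only [μ, List.length_append, List.length_replicate, Nat.add_sub_cancel]
      ring
    rw [hlen, Nat.cast_mul, ZMod.natCast_self, zero_mul]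
  have hμ : ∀ u v, g u = g v → μ.foldl (backward G ε) u = μ.foldl (backward G ε) v :=
    fun u v huv => by
      rw [List.foldl_append, List.foldl_append, hγ u v (hgh u v huv)]
  choose x hx using hU.nonempty
  refine ⟨c, hε.isStrongEdgeColoring, fun i => μ.foldl (backward G ε) (x i), μ, fun i => ?_,
    fun i v hv => ?_⟩
  · rw [hgU, hgfold, hμlen, sub_zero]
    exact (hgU _ _).1 (hx i)
  · beta_reduce
    rw [← hμ v (x i) (((hgU _ _).1 hv).trans ((hgU _ _).1 (hx i)).symm)]
    exact hε.exists_isPath μ v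

/-- A synchronizing word can be extended so as to reach a prescribed vertex of a component. -/
theorem exists_isSynchronizingWord [Finite E] (htrans : G.IsTransitive)
    (hreg : G.InDegreeRegular d) {U : ZMod p → Set V} (hU : G.IsCyclicPartition p U)
    {c : E → Fin d} (hc : G.IsStrongEdgeColoring c) {v : ZMod p → V} {γ : List (Fin d)}
    (hγ : G.IsSynchronizingWord c U v γ) {i : ZMod p} {x : V} (hx : x ∈ U i) :
    ∃ (w : ZMod p → V) (μ : List (Fin d)), w i = x ∧ G.IsSynchronizingWord c U w μ := by
  obtain ⟨ε, hε⟩ := exists_isEdgeSelection hreg hc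
  obtain ⟨g, hgU, hgedge⟩ := exists_label hU
  have hg : ∀ e, g (G.r e) = g (G.s e) + 1 := fun e => (hgU _ _).1 (hgedge e)
  obtain ⟨w, hw⟩ := hε.connected htrans (v i) x
  have hgfold := label_foldl hε.r_eq hg w
  -- Both ends of this path lie in `U i`, so `w` preserves every component and can be appended to
  -- `γ`.
  have hlen : (w.length : ZMod p) = 0 := by
    have := hgfold (v i)
    rwa [hw, (hgU _ _).1 hx, (hgU _ _).1 (hγ.1 i), eq_comm, sub_eq_self] at this
  refine ⟨fun j => w.foldl (backward G ε) (v j), γ ++ w, hw, fun j => ?_, fun j u hu => ?_⟩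
  · rw [hgU, hgfold, hlen, sub_zero]
    exact (hgU _ _).1 (hγ.1 j)
  · obtain ⟨l, hl, rfl⟩ := hγ.2 j u hu
    have := hε.exists_isPath (l.map c ++ w) u
    rwa [List.foldl_append, hε.foldl_map hl] at this

end Graphs

end RoadColoring

theorem corollary2 {V E : Type*} [Finite V] [Finite E] (G : DirectedGraph V E) (d p : ℕ)
    (htrans : G.IsTransitive) (hreg : G.InDegreeRegular d) (hper : G.HasPeriod p)
    (U : ZMod p → Set V) (hU : G.IsCyclicPartition p U) :
    (∃ c : E → Fin d, G.IsStrongEdgeColoring c ∧ G.IsSynchronizing c U) ∧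
    (∀ c : E → Fin d, G.IsStrongEdgeColoring c →
      ∀ (v : ZMod p → V) (γ : List (Fin d)), G.IsSynchronizingWord c U v γ →
        ∀ (i : ZMod p), ∀ wi ∈ U i,
          ∃ (w : ZMod p → V) (μ : List (Fin d)),
            w i = wi ∧ G.IsSynchronizingWord c U w μ) :=
  ⟨RoadColoring.exists_isSynchronizing htrans hreg hper hU, fun _ hc _ _ hγ _ _ hwi =>
    RoadColoring.exists_isSynchronizingWord htrans hreg hU hc hγ hwi⟩
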